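/- Let $C$ be the parabola $y=x^2$ in $\mathbb{R}^2$, and let $\mathcal L$ be a finite set of lines in general position: no line is vertical, no two lines are parallel, no three lines are concurrent, every line meets $C$, no line is tangent to $C$, and no two lines meet $C$ at the same point. Let $\mathcal L'$ be the set of segments obtained by intersecting each line of $\mathcal L$ with the convex hull of $C$, and assume that the intersection graph of $\mathcal L'$ (whose vertices are the segments, two being adjacent if they intersect) is connected. The segments of $\mathcal L'$ cut one another into pieces. Each piece has two directed copies (sub-segments), one on its lower side, directed rightwards, and one on its upper side, directed leftwards. Starting at the leftmost endpoint of $\mathcal L'$, walk along the sub-segments as if the segments were walls that are touched with the left hand at all times: at a crossing with another segment, turn into the half of that segment that lies on the side of the current segment on which one is walking; at an endpoint of a segment, go around it to the other side of the segment. Stop on reaching the rightmost endpoint of $\mathcal L'$ for the first time. The lower inner-zone sequence $S$ of $C$ in the arrangement of $\mathcal L$ is the sequence of the segments whose lower-side sub-segments are visited, in the order of the visits (one symbol for each visited lower-side sub-segment). Then $S$ contains no (not necessarily contiguous) subsequence isomorphic to the sequence $$u = 81ab12181cd12dedcbab34bc49434de49$$ of length $33$ on the eleven distinct symbols $a,b,c,d,e,1,2,3,4,8,9$,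 where two sequences are isomorphic if one is obtained from the other by an injective renaming of symbols. -/

import Mathlib

namespace ParabolaZone

/-- A non-vertical line of the plane, `y = slope * x + intercept`. -/
@[ext]
structure Line where
  slope : ℝ
  intercept : ℝ

/-- The `y`-coordinate of the point of the line with abscissa `x`. -/
def Line.height (a : Line) (x : ℝ) : ℝ := a.slope * x + a.intercept

/-- The parabola `C : y = x ^ 2`. -/
def parabola : Set (ℝ × ℝ) := {p | p.2 = p.1 ^ 2}

/-- The line as a set of points. -/
def Line.points (a : Line) : Set (ℝ × ℝ) := {p | p.2 = a.height p.1}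

/-- The segment cut out of the line by the convex hull of the parabola. -/
def Line.segment (a : Line) : Set (ℝ × ℝ) := a.points ∩ convexHull ℝ parabola

/-- `x` is the abscissa of an endpoint of the segment of `a`, that is, of a point
of `a` on the parabola. -/
def Line.IsEndpoint (a : Line) (x : ℝ) : Prop := (x, a.height x) ∈ parabola

/-- The line touches the parabola at some point without crossing it
(the slope of the parabola at abscissa `x` is `2 * x`). -/
def Line.IsTangent (a : Line) : Prop := ∃ x, a.IsEndpoint x ∧ a.slope = 2 * x

/-- General position of a finite set of (non-vertical) lines with respect to the parabola. -/
structure GeneralPosition (𝓛 : Finset Line) : Prop where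
  meets : ∀ a ∈ 𝓛, ∃ x, a.IsEndpoint x
  not_tangent : ∀ a ∈ 𝓛, ¬ a.IsTangent
  not_parallel : ∀ a ∈ 𝓛, ∀ b ∈ 𝓛, a ≠ b → a.slope ≠ b.slope
  not_concurrent : ∀ a ∈ 𝓛, ∀ b ∈ 𝓛, ∀ c ∈ 𝓛, a ≠ b → a ≠ c → b ≠ c →
    a.points ∩ b.points ∩ c.points = ∅
  endpoints_distinct : ∀ a ∈ 𝓛, ∀ b ∈ 𝓛, a ≠ b → ∀ x, ¬ (a.IsEndpoint x ∧ b.IsEndpoint x)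

/-- The intersection graph of the segments. -/
def intersectionGraph (𝓛 : Finset Line) : SimpleGraph 𝓛 where
  Adj a b := a ≠ b ∧ (a.1.segment ∩ b.1.segment).Nonempty
  symm := ⟨fun a b h => ⟨h.1.symm, by rw [Set.inter_comm]; exact h.2⟩⟩
  loopless := ⟨fun _ h => h.1 rfl⟩

/-- The abscissas at which the segment of `a` is subdivided: its two endpoints and its
intersections with the other segments. -/
def vertices (𝓛 : Finset Line) (a : Line) : Set ℝ :=
  {x | a.IsEndpoint x ∨ ∃ b ∈ 𝓛, b ≠ a ∧ (x, a.height x) ∈ a.segment ∩ b.segment}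

/-- The abscissas of all endpoints of the segments. -/
def endpoints (𝓛 : Finset Line) : Set ℝ := {x | ∃ a ∈ 𝓛, a.IsEndpoint x}

/-- The two sides of a segment: the negative (lower) and the positive (upper) one. -/
inductive Side
  | lower
  | upper

/-- One of the two directed copies of a piece of the segment of `line`, the piece with abscissas
in `[left, right]`. The copy on the lower side is directed to the right, the one on the upper
side is directed to the left. -/
structure SubSegment where
  line : Line
  left : ℝ
  right : ℝ
  side : Side

namespace SubSegment

/-- The abscissa of the initial point. -/
def source (d : SubSegment) : ℝ :=
  match d.side with
  | Side.lower => d.left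
  | Side.upper => d.right

/-- The abscissa of the terminal point. -/
def target (d : SubSegment) : ℝ :=
  match d.side with
  | Side.lower => d.right
  | Side.upper => d.left

/-- `d` comes from an actual piece: its line is one of the given lines, and its ends are
consecutive subdivision points of the segment. -/
structure Valid (𝓛 : Finset Line) (d : SubSegment) : Prop where
  line_mem : d.line ∈ 𝓛
  left_mem : d.left ∈ vertices 𝓛 d.line
  right_mem : d.right ∈ vertices 𝓛 d.line
  left_lt_right : d.left < d.right
  consecutive : ∀ x ∈ vertices 𝓛 d.line, ¬ (d.left < x ∧ x < d.right)

/-- The point `p` lies strictly on the side of the line of `d` on which `d` runs. -/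
def Faces (d : SubSegment) (p : ℝ × ℝ) : Prop :=
  match d.side with
  | Side.lower => p.2 < d.line.height p.1
  | Side.upper => d.line.height p.1 < p.2

/-- At the point where `d` ends it meets another segment, and the walk, which keeps its left hand
on the walls, turns into the half of that segment that lies on the side of `d` on which it has
been walking. -/
structure TurnsInto (d e : SubSegment) : Prop where
  line_ne : d.line ≠ e.line
  target_eq : d.target = e.source
  height_eq : d.line.height d.target = e.line.height e.source
  faces : d.Faces (e.target, e.line.height e.target)

/-- `d` ends at an endpoint of its segment, and the walk goes around this endpoint to the
other side of the segment. -/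
structure GoesAroundInto (d e : SubSegment) : Prop where
  line_eq : d.line = e.line
  side_ne : d.side ≠ e.side
  target_eq : d.target = e.source
  endpoint : d.line.IsEndpoint d.target

/-- `e` is the sub-segment visited immediately after `d`. -/
def Next (d e : SubSegment) : Prop := d.TurnsInto e ∨ d.GoesAroundInto e

end SubSegment

/-- The tour of the inner zone: the walk along the sub-segments that starts at the leftmost
endpoint `c₁`, keeps its left hand on the walls, and stops as soon as it reaches the
rightmost endpoint `c₂`. -/
structure IsTour (𝓛 : Finset Line) (T : List SubSegment) : Prop where
  valid : ∀ d ∈ T, d.Valid 𝓛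
  starts : ∃ d ∈ T.head?, IsLeast (endpoints 𝓛) d.source
  walks : T.IsChain SubSegment.Next
  stops : ∃ d ∈ T.getLast?, IsGreatest (endpoints 𝓛) d.target
  not_before : ∀ d ∈ T.dropLast, ¬ IsGreatest (endpoints 𝓛) d.target

/-- The symbol that a sub-segment contributes to the lower sequence: its line if it is on the
lower side, and nothing otherwise. -/
def SubSegment.lowerSymbol (d : SubSegment) : Option Line :=
  match d.side with
  | Side.lower => some d.line
  | Side.upper => none

/-- `S` is the lower inner-zone sequence of the parabola in the arrangement of `𝓛`: the
sequence of the lower-side symbols encountered along the tour. -/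
def IsLowerInnerZoneSequence (𝓛 : Finset Line) (S : List Line) : Prop :=
  ∃ T, IsTour 𝓛 T ∧ S = T.filterMap SubSegment.lowerSymbol

/-- Two sequences are isomorphic if one arises from the other by an injective renaming of
its symbols. -/
def Isomorphic {α β : Type*} (v : List α) (w : List β) : Prop :=
  ∃ f : α → β, Set.InjOn f {x | x ∈ v} ∧ w = v.map f

/-- The eleven symbols `a, b, c, d, e, 1, 2, 3, 4, 8, 9`. -/
inductive Letter
  | a | b | c | d | e | n1 | n2 | n3 | n4 | n8 | n9
  deriving DecidableEq

open Letter in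
/-- The pattern `81ab12181cd12dedcbab34bc49434de49`. -/
def pattern : List Letter :=
  [n8, n1, a, b, n1, n2, n1, n8, n1, c, d, n1, n2, d, e, d, c, b, a, b, n3, n4, b, c,
    n4, n9, n4, n3, n4, d, e, n4, n9]

end ParabolaZone

/-! A secant meets the parabola at abscissas `lo < hi`, and the point of the parabola at abscissa t
lies below it exactly when its `gap` at t is negative. Connectedness makes the tour go through the
faces along the parabola in the order of t, each clockwise as seen from its parabola point
(`InFace.exists_next`, `InFace.direction_lt`). A piece visited from below at t belongs to a chord
whose ends enclose t, and it runs below every other such chord.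

Hence chords that alternate as a b a b cross, with a starting first, and the two middle visits run
below the other chord (`alternates`, from `not_precedes_of_crossing`). The word thus becomes a
system of inequalities between chord ends.

In the pattern a, b, c, d, e cross pairwise, both their left and their right ends being in this
order. Let α, β, δ, ε be the distances of the left ends of a, b, d, e from that of c, and α', β',
δ', ε' those of the right ends. That b passes below the crossing of a and c, and d below that of c
and e, gives two cubic inequalities (`mul_lt_mul_of_below` and its mirror image). Chords 1 and 2,
whose crossing is kept left of c by chord 8, give αδ < βε; chords 3, 4 and 9 likewise give ε'β' <
δ'α'. Together these force both α'δ < β'ε and β'ε < α'δ (`false_of_distances`). -/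

namespace ParabolaZone

/-! ### Chords of the parabola -/

/-- The signed vertical distance from the line to the parabola at abscissa `t`: it is negative
exactly where the parabola runs below the line. -/
def Line.gap (a : Line) (t : ℝ) : ℝ := t ^ 2 - a.height t

/-- The abscissa of the left endpoint of the segment of `a`. -/
noncomputable def Line.lo (a : Line) : ℝ := (a.slope - √(a.slope ^ 2 + 4 * a.intercept)) / 2

/-- The abscissa of the right endpoint of the segment of `a`. -/
noncomputable def Line.hi (a : Line) : ℝ := (a.slope + √(a.slope ^ 2 + 4 * a.intercept)) / 2

lemma Line.isEndpoint_iff_gap {a : Line} {x : ℝ} : a.IsEndpoint x ↔ a.gap x = 0 := by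
  simp only [Line.IsEndpoint, parabola, Set.mem_ofPred_eq, Line.gap, sub_eq_zero]
  exact eq_comm

/-- A line that meets the parabola transversally. -/
def Line.IsSecant (a : Line) : Prop :=
  a.lo < a.hi ∧ a.slope = a.lo + a.hi ∧ a.intercept = -(a.lo * a.hi)

lemma Line.isSecant_of_meets {a : Line} (h : ∃ x, a.IsEndpoint x) (h' : ¬ a.IsTangent) :
    a.IsSecant := by
  obtain ⟨x, hx⟩ := h
  have hne : a.slope ≠ 2 * x := fun e => h' ⟨x, hx, e⟩
  rw [Line.isEndpoint_iff_gap, Line.gap, Line.height] at hx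
  -- At a common point the discriminant is the square of the difference of the two slopes, so it is
  -- positive unless the line is tangent.
  have hd : a.slope ^ 2 + 4 * a.intercept = (a.slope - 2 * x) ^ 2 := by linear_combination -4 * hx
  have hpos : 0 < a.slope ^ 2 + 4 * a.intercept := by
    have := sub_ne_zero.2 hne
    rw [hd]; positivity
  have hs := Real.sq_sqrt hpos.le
  have hs' := Real.sqrt_pos.2 hpos
  refine ⟨?_, ?_, ?_⟩ <;> simp only [Line.lo, Line.hi]
  · linarith
  · ring
  · linear_combination (-1 / 4) * hs

lemma GeneralPosition.isSecant {𝓛 : Finset Line} (h : GeneralPosition 𝓛) {a : Line}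
    (ha : a ∈ 𝓛) : a.IsSecant :=
  Line.isSecant_of_meets (h.meets a ha) (h.not_tangent a ha)

namespace Line.IsSecant

variable {a : Line}

lemma gap_eq (h : a.IsSecant) (t : ℝ) : a.gap t = (t - a.lo) * (t - a.hi) := by
  rw [Line.gap, Line.height, h.2.1, h.2.2]; ring

lemma height_eq (h : a.IsSecant) (t : ℝ) : a.height t = (a.lo + a.hi) * t - a.lo * a.hi := by
  rw [Line.height, h.2.1, h.2.2]; ring

lemma isEndpoint_iff (h : a.IsSecant) {x : ℝ} : a.IsEndpoint x ↔ x = a.lo ∨ x = a.hi := by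
  rw [Line.isEndpoint_iff_gap, h.gap_eq, mul_eq_zero, sub_eq_zero, sub_eq_zero]

lemma gap_nonpos_iff (h : a.IsSecant) {x : ℝ} : a.gap x ≤ 0 ↔ a.lo ≤ x ∧ x ≤ a.hi := by
  have := h.1
  rw [h.gap_eq]
  constructor
  · intro hx
    constructor <;> by_contra! hc
    · nlinarith [mul_pos (sub_pos.2 hc) (sub_pos.2 (hc.trans this))]
    · nlinarith [mul_pos (sub_pos.2 hc) (sub_pos.2 (this.trans hc))]
  · rintro ⟨h1, h2⟩
    nlinarith [mul_nonneg (sub_nonneg.2 h1) (sub_nonneg.2 h2)]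

lemma gap_neg_iff (h : a.IsSecant) {x : ℝ} : a.gap x < 0 ↔ a.lo < x ∧ x < a.hi := by
  have := h.1
  rw [h.gap_eq]
  constructor
  · intro hx
    constructor <;> by_contra! hc
    · nlinarith [mul_nonneg (sub_nonneg.2 hc) (sub_nonneg.2 (hc.trans this.le))]
    · nlinarith [mul_nonneg (sub_nonneg.2 hc) (sub_nonneg.2 (this.le.trans hc))]
  · rintro ⟨h1, h2⟩
    nlinarith [mul_pos (sub_pos.2 h1) (sub_pos.2 h2)]

lemma gap_pos_iff (h : a.IsSecant) {x : ℝ} : 0 < a.gap x ↔ x < a.lo ∨ a.hi < x := by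
  rw [← not_le, h.gap_nonpos_iff, not_and_or, not_le, not_le]

end Line.IsSecant

lemma mem_convexHull_parabola {p : ℝ × ℝ} : p ∈ convexHull ℝ parabola ↔ p.1 ^ 2 ≤ p.2 := by
  constructor
  · intro hp
    have hc : Convex ℝ {p : ℝ × ℝ | p.1 ∈ (Set.univ : Set ℝ) ∧ p.1 ^ 2 ≤ p.2} :=
      (even_two.convexOn_pow (𝕜 := ℝ)).convex_epigraph
    have hsub : parabola ⊆ {p : ℝ × ℝ | p.1 ∈ (Set.univ : Set ℝ) ∧ p.1 ^ 2 ≤ p.2} :=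
      fun q hq => ⟨trivial, (show q.2 = q.1 ^ 2 from hq).ge⟩
    exact (convexHull_min hsub hc hp).2
  · intro hp
    -- The mean of the squares of `p.1 ± s` is `p.1 ^ 2 + s ^ 2`, so `p` is the midpoint of these
    -- two points of the parabola.
    set s := √(p.2 - p.1 ^ 2) with hs
    have hs2 : s ^ 2 = p.2 - p.1 ^ 2 := Real.sq_sqrt (by linarith)
    have h1 : (p.1 + s, (p.1 + s) ^ 2) ∈ convexHull ℝ parabola := subset_convexHull _ _ rfl
    have h2 : (p.1 - s, (p.1 - s) ^ 2) ∈ convexHull ℝ parabola := subset_convexHull _ _ rfl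
    have := (convex_convexHull ℝ parabola) h1 h2 (by norm_num : (0 : ℝ) ≤ 1 / 2)
      (by norm_num : (0 : ℝ) ≤ 1 / 2) (by norm_num)
    convert this using 1
    ext
    · simp; ring
    · simp only [Prod.smul_mk, Prod.mk_add_mk, smul_eq_mul]; linear_combination -hs2

lemma Line.mem_segment_iff {a : Line} {p : ℝ × ℝ} :
    p ∈ a.segment ↔ p.2 = a.height p.1 ∧ a.gap p.1 ≤ 0 := by
  rw [Line.segment, Set.mem_inter_iff, mem_convexHull_parabola, Line.gap]
  change p.2 = a.height p.1 ∧ _ ↔ _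
  constructor <;> rintro ⟨h1, h2⟩ <;> exact ⟨h1, by linarith⟩

lemma mem_vertices_of_crossing {𝓛 : Finset Line} {a b : Line} (hb : b ∈ 𝓛) (hab : b ≠ a) {x : ℝ}
    (hx : a.height x = b.height x) (hg : a.gap x ≤ 0) : x ∈ vertices 𝓛 a := by
  refine Or.inr ⟨b, hb, hab, Line.mem_segment_iff.2 ⟨rfl, hg⟩, Line.mem_segment_iff.2 ⟨hx, ?_⟩⟩
  simp only [Line.gap] at hg ⊢
  linarith

lemma gap_nonpos_of_mem_vertices {𝓛 : Finset Line} {a : Line} {x : ℝ}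
    (hx : x ∈ vertices 𝓛 a) : a.gap x ≤ 0 := by
  rcases hx with hx | ⟨b, -, -, hx, -⟩
  · exact (Line.isEndpoint_iff_gap.1 hx).le
  · exact (Line.mem_segment_iff.1 hx).2

/-! ### Consequences of general position and connectedness -/

section Position

variable {𝓛 : Finset Line}

lemma mem_endpoints_lo (hpos : GeneralPosition 𝓛) {a : Line} (ha : a ∈ 𝓛) :
    a.lo ∈ endpoints 𝓛 := ⟨a, ha, (hpos.isSecant ha).isEndpoint_iff.2 (Or.inl rfl)⟩

lemma mem_endpoints_hi (hpos : GeneralPosition 𝓛) {a : Line} (ha : a ∈ 𝓛) :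
    a.hi ∈ endpoints 𝓛 := ⟨a, ha, (hpos.isSecant ha).isEndpoint_iff.2 (Or.inr rfl)⟩

lemma gap_ne_zero_of_notMem_endpoints {a : Line} (ha : a ∈ 𝓛) {t : ℝ} (ht : t ∉ endpoints 𝓛) :
    a.gap t ≠ 0 := fun h => ht ⟨a, ha, Line.isEndpoint_iff_gap.2 h⟩

lemma finite_endpoints (hpos : GeneralPosition 𝓛) : (endpoints 𝓛).Finite := by
  refine ((𝓛.finite_toSet.image Line.lo).union (𝓛.finite_toSet.image Line.hi)).subset ?_
  rintro x ⟨a, ha, hx⟩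
  rcases (hpos.isSecant ha).isEndpoint_iff.1 hx with rfl | rfl
  · exact Or.inl ⟨a, ha, rfl⟩
  · exact Or.inr ⟨a, ha, rfl⟩

/-- Just after any abscissa there is an interval free of endpoints. -/
lemma exists_gt_forall_notMem_endpoints (hpos : GeneralPosition 𝓛) (q : ℝ) :
    ∃ t > q, ∀ x, q < x → x ≤ t → x ∉ endpoints 𝓛 := by
  have hf : ((endpoints 𝓛) \ {q}).Finite := (finite_endpoints hpos).subset Set.sdiff_subset
  have hn : ((endpoints 𝓛) \ {q})ᶜ ∈ nhds q := hf.isClosed.isOpen_compl.mem_nhds (by simp)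
  obtain ⟨ε, hε, hb⟩ := Metric.mem_nhds_iff.1 hn
  refine ⟨q + ε / 2, by linarith, fun x h1 h2 hx => ?_⟩
  have : x ∈ Metric.ball q ε := by
    rw [Metric.mem_ball, Real.dist_eq, abs_lt]; constructor <;> linarith
  exact hb this ⟨hx, h1.ne'⟩

lemma exists_adjacent_of_connected (hconn : (intersectionGraph 𝓛).Connected) (P : Line → Prop)
    {a b : Line} (ha : a ∈ 𝓛) (hb : b ∈ 𝓛) (hPa : P a) (hPb : ¬ P b) :
    ∃ c ∈ 𝓛, ∃ d ∈ 𝓛, P c ∧ ¬ P d ∧ (c.segment ∩ d.segment).Nonempty := by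
  obtain ⟨w⟩ := hconn.preconnected ⟨a, ha⟩ ⟨b, hb⟩
  obtain ⟨d, -, h1, h2⟩ := w.exists_boundary_dart {x | P x.1} hPa hPb
  exact ⟨d.fst.1, d.fst.2, d.snd.1, d.snd.2, h1, h2, d.adj.2⟩

lemma ends_ne (hpos : GeneralPosition 𝓛) {a b : Line} (ha : a ∈ 𝓛) (hb : b ∈ 𝓛) (hab : a ≠ b) :
    a.lo ≠ b.lo ∧ a.lo ≠ b.hi ∧ a.hi ≠ b.lo ∧ a.hi ≠ b.hi := by
  have key := hpos.endpoints_distinct a ha b hb hab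
  simp only [(hpos.isSecant ha).isEndpoint_iff, (hpos.isSecant hb).isEndpoint_iff] at key
  exact ⟨fun h => key _ ⟨Or.inl rfl, Or.inl h⟩, fun h => key _ ⟨Or.inl rfl, Or.inr h⟩,
    fun h => key _ ⟨Or.inr rfl, Or.inl h⟩, fun h => key _ ⟨Or.inr rfl, Or.inr h⟩⟩

/-- If no chord has exactly one end in `[u, v]`, then by connectedness the chords lie either all
inside or all outside. -/
lemma inside_of_connected (hpos : GeneralPosition 𝓛) (hconn : (intersectionGraph 𝓛).Connected)
    {u v : ℝ}
    (h : ∀ k ∈ 𝓛, (u ≤ k.lo ∧ k.hi ≤ v) ∨ k.hi ≤ u ∨ v ≤ k.lo ∨ (k.lo ≤ u ∧ v ≤ k.hi))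
    {a : Line} (ha : a ∈ 𝓛) (hau : u ≤ a.lo) (hav : a.hi ≤ v) :
    ∀ b ∈ 𝓛, u ≤ b.lo ∧ b.hi ≤ v := by
  intro b hb
  by_contra hPb
  obtain ⟨c, hc, d, hd, h1, h2, ⟨x, y⟩, hxc, hxd⟩ := exists_adjacent_of_connected hconn
    (fun k => u ≤ k.lo ∧ k.hi ≤ v) ha hb ⟨hau, hav⟩ hPb
  have hcd : c ≠ d := by rintro rfl; exact h2 h1
  obtain ⟨n1, n3, n4, n2⟩ := ends_ne hpos hc hd hcd
  rw [Line.mem_segment_iff] at hxc hxd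
  have sc := hpos.isSecant hc
  have sd := hpos.isSecant hd
  obtain ⟨e1, g1⟩ := hxc
  obtain ⟨e2, g2⟩ := hxd
  have hg : c.gap x = d.gap x := by
    simp only [Line.gap]; simp only at e1 e2; rw [← e1, ← e2]
  obtain ⟨x1, x2⟩ := sc.gap_nonpos_iff.1 g1
  obtain ⟨x3, x4⟩ := sd.gap_nonpos_iff.1 g2
  simp only at x1 x2 x3 x4
  rcases h d hd with h3 | h3 | h3 | ⟨h3, h4⟩
  · exact h2 h3
  · exact n3 (le_antisymm (x1.trans x4) (h3.trans h1.1))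
  · exact n4 (le_antisymm (h1.2.trans h3) (x3.trans x2))
  -- A chord that strictly encloses another has a strictly smaller gap over it, so the two cannot
  -- meet.
  · have l1 : d.lo < c.lo := lt_of_le_of_ne (h3.trans h1.1) n1.symm
    have l2 : c.hi < d.hi := lt_of_le_of_ne (h1.2.trans h4) n2
    rw [sc.gap_eq, sd.gap_eq] at hg
    nlinarith [mul_pos (sub_pos.2 l1) (sub_pos.2 (x2.trans_lt l2)),
      mul_nonneg (sub_nonneg.2 x1) (sub_pos.2 l2).le]

lemma in_or_out_of_gap_mul_pos {k : Line} (hk : k.IsSecant) {u v : ℝ}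
    (h : 0 < k.gap u * k.gap v) :
    (u ≤ k.lo ∧ k.hi ≤ v) ∨ k.hi ≤ u ∨ v ≤ k.lo ∨ (k.lo ≤ u ∧ v ≤ k.hi) := by
  rcases pos_and_pos_or_neg_and_neg_of_mul_pos h with ⟨h1, h2⟩ | ⟨h1, h2⟩
  · rcases hk.gap_pos_iff.1 h1 with h1 | h1
    · rcases hk.gap_pos_iff.1 h2 with h2 | h2
      · exact Or.inr (Or.inr (Or.inl h2.le))
      · exact Or.inl ⟨h1.le, h2.le⟩
    · exact Or.inr (Or.inl h1.le)
  · exact Or.inr (Or.inr (Or.inr ⟨(hk.gap_neg_iff.1 h1).1.le, (hk.gap_neg_iff.1 h2).2.le⟩))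

end Position

/-! ### The faces along the tour -/

/-- The sub-segment `d` bounds, on the side on which it runs, the face of the arrangement that
contains the point of the parabola with abscissa `t`, and `t` lies before the last endpoint. -/
structure InFace (𝓛 : Finset Line) (t : ℝ) (d : SubSegment) : Prop where
  valid : d.Valid 𝓛
  notMem : t ∉ endpoints 𝓛
  before : ∃ c ∈ endpoints 𝓛, t < c
  lower : d.side = Side.lower → d.line.gap t < 0
  upper : d.side = Side.upper → 0 < d.line.gap t
  left : ∀ k ∈ 𝓛, k ≠ d.line → 0 ≤ (d.line.height d.left - k.height d.left) * k.gap t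
  right : ∀ k ∈ 𝓛, k ≠ d.line → 0 ≤ (d.line.height d.right - k.height d.right) * k.gap t

section Face

variable {𝓛 : Finset Line}

lemma nonneg_mul_of_pos_mul {a b g : ℝ} (h : 0 < a * g) (h' : 0 ≤ a * b) : 0 ≤ b * g := by
  rcases pos_and_pos_or_neg_and_neg_of_mul_pos h with ⟨h1, h2⟩ | ⟨h1, h2⟩
  · exact mul_nonneg (nonneg_of_mul_nonneg_right h' h1) h2.le
  · exact mul_nonneg_of_nonpos_of_nonpos (by by_contra! hb; nlinarith) h2.le

/-- No line crosses the interior of a piece. -/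
lemma SubSegment.Valid.height_sub_mul_nonneg (hpos : GeneralPosition 𝓛) {d : SubSegment}
    (hd : d.Valid 𝓛) {k : Line} (hk : k ∈ 𝓛) (hkd : k ≠ d.line) :
    0 ≤ (d.line.height d.left - k.height d.left) * (d.line.height d.right - k.height d.right) := by
  have hm : d.line.slope - k.slope ≠ 0 :=
    sub_ne_zero.2 (hpos.not_parallel _ hd.line_mem _ hk hkd.symm)
  set m := d.line.slope - k.slope with hm'
  -- The abscissa where `k` crosses the line of `d`; a sign change along the piece would make it a
  -- subdivision point strictly inside.
  set x := (k.intercept - d.line.intercept) / m with hx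
  have hf : ∀ y, d.line.height y - k.height y = m * (y - x) := by
    intro y
    have : m * x = k.intercept - d.line.intercept := by rw [hx]; field_simp
    rw [mul_sub, this, hm', Line.height, Line.height]; ring
  rw [hf, hf]
  by_contra! hneg
  have hlr := hd.left_lt_right
  have hm2 : 0 < m ^ 2 := by positivity
  have h0 : (d.left - x) * (d.right - x) < 0 := by
    by_contra! h
    nlinarith [mul_nonneg hm2.le h]
  have h1 : d.left < x := by
    by_contra! h
    nlinarith [mul_nonneg (sub_nonneg.2 h) (sub_nonneg.2 (h.trans hlr.le))]
  have h2 : x < d.right := by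
    by_contra! h
    nlinarith [mul_nonneg (sub_nonneg.2 h) (sub_nonneg.2 (hlr.le.trans h))]
  have hs := hpos.isSecant hd.line_mem
  have g1 := hs.gap_nonpos_iff.1 (gap_nonpos_of_mem_vertices hd.left_mem)
  have g2 := hs.gap_nonpos_iff.1 (gap_nonpos_of_mem_vertices hd.right_mem)
  refine hd.consecutive x (mem_vertices_of_crossing hk hkd ?_ ?_) ⟨h1, h2⟩
  · have := hf x
    rw [sub_self, mul_zero] at this
    linarith
  · exact hs.gap_nonpos_iff.2 ⟨g1.1.trans h1.le, h2.le.trans g2.2⟩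

lemma InFace.source {t : ℝ} {d : SubSegment} (h : InFace 𝓛 t d)
    {k : Line} (hk : k ∈ 𝓛) (hkd : k ≠ d.line) :
    0 ≤ (d.line.height d.source - k.height d.source) * k.gap t := by
  cases hs : d.side <;> simp only [SubSegment.source, hs]
  exacts [h.left k hk hkd, h.right k hk hkd]

lemma InFace.target {t : ℝ} {d : SubSegment} (h : InFace 𝓛 t d)
    {k : Line} (hk : k ∈ 𝓛) (hkd : k ≠ d.line) :
    0 ≤ (d.line.height d.target - k.height d.target) * k.gap t := by
  cases hs : d.side <;> simp only [SubSegment.target, hs]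
  exacts [h.right k hk hkd, h.left k hk hkd]

lemma InFace.of_source_target {t : ℝ} {d : SubSegment} (hv : d.Valid 𝓛) (hn : t ∉ endpoints 𝓛)
    (hb : ∃ c ∈ endpoints 𝓛, t < c) (hl : d.side = Side.lower → d.line.gap t < 0)
    (hu : d.side = Side.upper → 0 < d.line.gap t)
    (h : ∀ k ∈ 𝓛, k ≠ d.line →
      0 ≤ (d.line.height d.source - k.height d.source) * k.gap t ∧
      0 ≤ (d.line.height d.target - k.height d.target) * k.gap t) : InFace 𝓛 t d := by
  refine ⟨hv, hn, hb, hl, hu, fun k hk hkd => ?_, fun k hk hkd => ?_⟩ <;>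
  · have := h k hk hkd
    cases hs : d.side <;> simp only [SubSegment.source, SubSegment.target, hs] at this
    first | exact this.1 | exact this.2
    first | exact this.2 | exact this.1

lemma SubSegment.Valid.source_mul_target_nonneg (hpos : GeneralPosition 𝓛) {d : SubSegment}
    (hd : d.Valid 𝓛) {k : Line} (hk : k ∈ 𝓛) (hkd : k ≠ d.line) :
    0 ≤ (d.line.height d.source - k.height d.source) *
      (d.line.height d.target - k.height d.target) := by
  have := hd.height_sub_mul_nonneg hpos hk hkd
  cases hs : d.side <;> simp only [SubSegment.source, SubSegment.target, hs]
  · exact this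
  · rwa [mul_comm]

/-- Turning at a crossing does not leave the face. -/
lemma InFace.of_turnsInto (hpos : GeneralPosition 𝓛) {t : ℝ} {d e : SubSegment}
    (h : InFace 𝓛 t d) (he : e.Valid 𝓛) (hde : d.TurnsInto e) : InFace 𝓛 t e := by
  have hd := h.valid
  obtain ⟨hne, htgt, hht, hfaces⟩ := hde
  have hgd := gap_ne_zero_of_notMem_endpoints hd.line_mem h.notMem
  have hge := gap_ne_zero_of_notMem_endpoints he.line_mem h.notMem
  have hsrc := h.source he.line_mem hne.symm
  have hlin : ∀ x, d.line.height x - e.line.height x =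
      (d.line.slope - e.line.slope) * (x - e.source) := by
    intro x
    rw [htgt] at hht
    simp only [Line.height] at hht ⊢
    linear_combination hht
  rw [hlin] at hsrc
  have hf := hlin e.target
  have hdl := hd.left_lt_right
  have hel := he.left_lt_right
  -- `faces` gives the sign of the slope difference; since the side of `e.line` on which `d.source`
  -- lies is known, this determines the sign of `e.line.gap t`.
  refine InFace.of_source_target he h.notMem h.before ?_ ?_ ?_
  · intro hs
    refine lt_of_le_of_ne ?_ hge
    cases hs' : d.side <;>
      simp only [SubSegment.Faces, SubSegment.source, SubSegment.target, hs, hs']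
        at hfaces htgt hsrc hf
    · have hm : 0 < d.line.slope - e.line.slope := by
        by_contra! hm; nlinarith
      by_contra! hg
      nlinarith [mul_pos (mul_pos hm (sub_pos.2 hdl)) hg]
    · have hm : d.line.slope - e.line.slope < 0 := by
        by_contra! hm; nlinarith
      by_contra! hg
      nlinarith [mul_pos (mul_pos (neg_pos.2 hm) (sub_pos.2 hdl)) hg]
  · intro hs
    refine lt_of_le_of_ne ?_ hge.symm
    cases hs' : d.side <;>
      simp only [SubSegment.Faces, SubSegment.source, SubSegment.target, hs, hs']
        at hfaces htgt hsrc hf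
    · have hm : d.line.slope - e.line.slope < 0 := by
        by_contra! hm; nlinarith
      by_contra! hg
      nlinarith [mul_pos (mul_pos (neg_pos.2 hm) (sub_pos.2 hdl)) (neg_pos.2 hg)]
    · have hm : 0 < d.line.slope - e.line.slope := by
        by_contra! hm; nlinarith
      by_contra! hg
      nlinarith [mul_pos (mul_pos hm (sub_pos.2 hdl)) (neg_pos.2 hg)]
  · intro k hk hke
    by_cases hkd : k = d.line
    · subst hkd
      constructor
      · rw [← hht, htgt, sub_self, zero_mul]
      · cases hs' : d.side <;> simp only [SubSegment.Faces, hs'] at hfaces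
        · nlinarith [mul_pos (sub_pos.2 hfaces) (neg_pos.2 (h.lower hs'))]
        · exact (mul_pos (sub_pos.2 hfaces) (h.upper hs')).le
    · have h1 := h.target hk hkd
      rw [hht, htgt] at h1
      -- No third line passes through the turning point, so the sign there is strict and carries
      -- over to the other end of `e`.
      have h2 : e.line.height e.source - k.height e.source ≠ 0 := by
        intro h0
        have := hpos.not_concurrent _ hd.line_mem _ he.line_mem _ hk hne (Ne.symm hkd)
          (Ne.symm hke)
        have hmem : (e.source, e.line.height e.source) ∈
            d.line.points ∩ e.line.points ∩ k.points := by
          refine ⟨⟨?_, rfl⟩, ?_⟩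
          · change _ = d.line.height e.source
            rw [← hht, htgt]
          · change _ = k.height e.source
            exact sub_eq_zero.1 h0
        rw [this] at hmem
        exact hmem
      have h3 := lt_of_le_of_ne h1
        (mul_ne_zero h2 (gap_ne_zero_of_notMem_endpoints hk h.notMem)).symm
      exact ⟨h1, nonneg_mul_of_pos_mul h3 (he.source_mul_target_nonneg hpos hk hke)⟩

/-! ### Clockwise order within a face -/

/-- The direction in which the point of `a` with abscissa `x` is seen from the point of the
parabola with abscissa `t`: it increases as the direction turns clockwise. -/
noncomputable def Line.direction (a : Line) (t x : ℝ) : ℝ :=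
  (x - t) / (a.height x - 2 * t * x + t ^ 2)

/-- The denominator is the height above the tangent to the parabola at `t`, which is positive on the
hull away from the point of contact. -/
lemma direction_denom_pos {a : Line} {t x : ℝ} (hx : a.gap x ≤ 0) (ht : a.gap t ≠ 0) :
    0 < a.height x - 2 * t * x + t ^ 2 := by
  have h1 : a.height x - 2 * t * x + t ^ 2 = -a.gap x + (x - t) ^ 2 := by
    rw [Line.gap]; ring
  rcases eq_or_ne x t with rfl | h
  · rw [h1]; have := lt_of_le_of_ne hx ht; nlinarith
  · have : x - t ≠ 0 := sub_ne_zero.2 h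
    have : 0 < (x - t) ^ 2 := by positivity
    linarith

lemma direction_lt_direction_iff {a b : Line} {t x y : ℝ} (hx : a.gap x ≤ 0) (ha : a.gap t ≠ 0)
    (hy : b.gap y ≤ 0) (hb : b.gap t ≠ 0) :
    a.direction t x < b.direction t y ↔
      (x - t) * (b.height y - 2 * t * y + t ^ 2) < (y - t) * (a.height x - 2 * t * x + t ^ 2) :=
  div_lt_div_iff₀ (direction_denom_pos hx ha) (direction_denom_pos hy hb)

/-- For two points of one line the cross product of the view vectors is proportional to their
displacement, and the factor records on which side of the line the viewer stands. -/
lemma direction_sub_identity (a : Line) (t x y : ℝ) :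
    (y - t) * (a.height x - 2 * t * x + t ^ 2) - (x - t) * (a.height y - 2 * t * y + t ^ 2) =
      -(a.gap t * (y - x)) := by
  simp only [Line.gap, Line.height]; ring

lemma direction_lt_of_gap_neg {a : Line} {t x y : ℝ} (ht : a.gap t < 0) (hx : a.gap x ≤ 0)
    (hy : a.gap y ≤ 0) (hxy : x < y) : a.direction t x < a.direction t y := by
  rw [direction_lt_direction_iff hx ht.ne hy ht.ne, ← sub_pos, direction_sub_identity]
  nlinarith [mul_pos (neg_pos.2 ht) (sub_pos.2 hxy)]

lemma direction_lt_of_gap_pos {a : Line} {t x y : ℝ} (ht : 0 < a.gap t) (hx : a.gap x ≤ 0)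
    (hy : a.gap y ≤ 0) (hxy : x < y) : a.direction t y < a.direction t x := by
  rw [direction_lt_direction_iff hy ht.ne' hx ht.ne', ← sub_pos, direction_sub_identity]
  nlinarith [mul_pos ht (sub_pos.2 hxy)]

/-- Moving right on a line above the viewer and moving left on a line below are both clockwise. -/
lemma InFace.direction_lt {t : ℝ} {d : SubSegment} (h : InFace 𝓛 t d) :
    d.line.direction t d.source < d.line.direction t d.target := by
  have h1 := gap_nonpos_of_mem_vertices h.valid.left_mem
  have h2 := gap_nonpos_of_mem_vertices h.valid.right_mem
  cases hs : d.side <;> simp only [SubSegment.source, SubSegment.target, hs]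
  · exact direction_lt_of_gap_neg (h.lower hs) h1 h2 h.valid.left_lt_right
  · exact direction_lt_of_gap_pos (h.upper hs) h1 h2 h.valid.left_lt_right

/-- The sub-segment `v.1`, seen in the face of `v.2`, precedes `w.1`, seen in the face of `w.2`. -/
def Precedes (𝓛 : Finset Line) (v w : SubSegment × ℝ) : Prop :=
  (∃ q ∈ endpoints 𝓛, v.2 < q ∧ q < w.2) ∨
    v.2 = w.2 ∧ v.1.line.direction v.2 v.1.target ≤ w.1.line.direction w.2 w.1.source

lemma Precedes.le {v w : SubSegment × ℝ} (h : Precedes 𝓛 v w) : v.2 ≤ w.2 := by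
  rcases h with ⟨q, -, h1, h2⟩ | ⟨h, -⟩
  exacts [(h1.trans h2).le, h.le]

lemma Precedes.trans {u v w : SubSegment × ℝ} (hv : InFace 𝓛 v.2 v.1) (h : Precedes 𝓛 u v)
    (h' : Precedes 𝓛 v w) : Precedes 𝓛 u w := by
  rcases h with ⟨q, hq, h1, h2⟩ | ⟨h1, h2⟩
  · exact Or.inl ⟨q, hq, h1, h2.trans_le h'.le⟩
  · rcases h' with ⟨q, hq, h3, h4⟩ | ⟨h3, h4⟩
    · exact Or.inl ⟨q, hq, h1.trans_lt h3, h4⟩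
    · exact Or.inr ⟨h1.trans h3, h2.trans (hv.direction_lt.le.trans h4)⟩

/-! ### Passing from one face to the next -/

/-- If the walk along the face of `t` reaches an endpoint, it is the first one after `t`. -/
lemma InFace.next_endpoint (hpos : GeneralPosition 𝓛) (hconn : (intersectionGraph 𝓛).Connected)
    {t : ℝ} {d : SubSegment} (h : InFace 𝓛 t d) (hend : d.line.IsEndpoint d.target) :
    t < d.target ∧ ∀ x ∈ endpoints 𝓛, t < x → d.target ≤ x := by
  have hd := h.valid
  have hi := hd.line_mem
  have si := hpos.isSecant hi
  have hgap : d.line.gap d.target = 0 := Line.isEndpoint_iff_gap.1 hend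
  -- At a point of the parabola the height difference is the gap of `k`, so the face condition puts
  -- `t` and the endpoint on the same side of every other line.
  have hsame : ∀ k ∈ 𝓛, k ≠ d.line → 0 < k.gap t * k.gap d.target := by
    intro k hk hkd
    have h1 := h.target hk hkd
    have h2 : d.line.height d.target - k.height d.target = k.gap d.target := by
      rw [Line.gap] at hgap ⊢; linarith
    rw [h2] at h1
    have h3 : k.gap d.target ≠ 0 := fun h0 =>
      hpos.endpoints_distinct k hk _ hi hkd _ ⟨Line.isEndpoint_iff_gap.2 h0, hend⟩
    rw [mul_comm]
    exact lt_of_le_of_ne h1 (mul_ne_zero h3 (gap_ne_zero_of_notMem_endpoints hk h.notMem)).symm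
  have hq := si.isEndpoint_iff.1 hend
  have g1 := si.gap_nonpos_iff.1 (gap_nonpos_of_mem_vertices hd.left_mem)
  have g2 := si.gap_nonpos_iff.1 (gap_nonpos_of_mem_vertices hd.right_mem)
  have hlr := hd.left_lt_right
  have hall :
      (d.line.lo < t ∧ d.target = d.line.hi ∨ d.target = d.line.lo) → ∀ k ∈ 𝓛,
      (t ≤ k.lo ∧ k.hi ≤ d.target) ∨ k.hi ≤ t ∨ d.target ≤ k.lo ∨
        (k.lo ≤ t ∧ d.target ≤ k.hi) := by
    intro hcase k hk
    by_cases hkd : k = d.line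
    · subst hkd
      rcases hcase with ⟨h1, h2⟩ | h1
      · exact Or.inr (Or.inr (Or.inr ⟨h1.le, h2.le⟩))
      · exact Or.inr (Or.inr (Or.inl h1.le))
    · exact in_or_out_of_gap_mul_pos (hpos.isSecant hk) (hsame k hk hkd)
  have forward : (d.line.lo < t ∧ d.target = d.line.hi ∨ d.target = d.line.lo) →
      ∀ x ∈ endpoints 𝓛, t < x → d.target ≤ x := by
    rintro hcase x ⟨k, hk, hkx⟩ htx
    by_contra! hxq
    -- A chord with an end strictly between `t` and `d.target` lies wholly between them;
    -- connectedness would then put every chord there, including that of `d`.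
    have hP : t ≤ k.lo ∧ k.hi ≤ d.target := by
      have hlt := (hpos.isSecant hk).1
      have hx := (hpos.isSecant hk).isEndpoint_iff.1 hkx
      rcases hall hcase k hk with hP | h1 | h1 | ⟨h1, h2⟩
      · exact hP
      all_goals rcases hx with rfl | rfl <;> exfalso <;> linarith
    have hPi := inside_of_connected hpos hconn (hall hcase) hk hP.1 hP.2 _ hi
    rcases hcase with ⟨h1, -⟩ | h1
    · exact h1.not_ge hPi.1
    · exact (h1 ▸ si.1).not_ge hPi.2
  cases hs : d.side
  · have htgt : d.target = d.line.hi := by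
      rcases hq with hq | hq
      · simp only [SubSegment.target, hs] at hq
        linarith
      · exact hq
    obtain ⟨t1, t2⟩ := si.gap_neg_iff.1 (h.lower hs)
    have htq : t < d.target := htgt ▸ t2
    exact ⟨htq, forward (Or.inl ⟨t1, htgt⟩)⟩
  · have htgt : d.target = d.line.lo := by
      rcases hq with hq | hq
      · exact hq
      · simp only [SubSegment.target, hs] at hq
        linarith
    rcases si.gap_pos_iff.1 (h.upper hs) with ht | ht
    · have htq : t < d.target := htgt ▸ ht
      exact ⟨htq, forward (Or.inr htgt)⟩
    -- Walking back to the left end of a chord that ends before `t` would confine all chords to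
    -- abscissas before `t`, against `before`.
    · exfalso
      obtain ⟨c, ⟨k, hk, hkc⟩, htc⟩ := h.before
      have hPk := inside_of_connected hpos hconn (u := d.target) (v := t) (fun k hk => by
        by_cases hkd : k = d.line
        · subst hkd; exact Or.inl ⟨htgt.le, ht.le⟩
        · refine in_or_out_of_gap_mul_pos (hpos.isSecant hk) ?_
          rw [mul_comm]
          exact hsame k hk hkd) hi htgt.le ht.le k hk
      have hlt := (hpos.isSecant hk).1
      rcases (hpos.isSecant hk).isEndpoint_iff.1 hkc with rfl | rfl <;> linarith

/-- Going around the last point of the face of `t` leads to the next face. -/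
lemma InFace.of_goesAroundInto (hpos : GeneralPosition 𝓛)
    (hconn : (intersectionGraph 𝓛).Connected) {t : ℝ} {d e : SubSegment}
    (h : InFace 𝓛 t d) (he : e.Valid 𝓛) (hde : d.GoesAroundInto e)
    (hlast : ¬ IsGreatest (endpoints 𝓛) d.target) :
    ∃ t', InFace 𝓛 t' e ∧ t < d.target ∧ d.target < t' := by
  obtain ⟨hline, hside, htgt, hend⟩ := hde
  have hd := h.valid
  have hi := hd.line_mem
  have si := hpos.isSecant hi
  obtain ⟨htq, hnext⟩ := h.next_endpoint hpos hconn hend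
  obtain ⟨t', ht', hfree⟩ := exists_gt_forall_notMem_endpoints hpos d.target
  have hqmem : d.target ∈ endpoints 𝓛 := ⟨_, hi, hend⟩
  have hbefore : ∃ c ∈ endpoints 𝓛, t' < c := by
    by_contra! hc
    refine hlast ⟨hqmem, fun x hx => ?_⟩
    by_contra! hqx
    exact hfree x hqx (hc x hx) hx
  have hnear : ∀ x ∈ endpoints 𝓛, x < t ∨ x = d.target ∨ t' < x := by
    intro x hx
    rcases lt_trichotomy x t with h1 | h1 | h1
    · exact Or.inl h1
    · exact absurd (h1 ▸ hx) h.notMem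
    · rcases (hnext x hx h1).lt_or_eq with h2 | h2
      · right; right
        by_contra! h3
        exact hfree x h2 h3 hx
      · exact Or.inr (Or.inl h2.symm)
  have hq := si.isEndpoint_iff.1 hend
  have g1 := si.gap_nonpos_iff.1 (gap_nonpos_of_mem_vertices hd.left_mem)
  have g2 := si.gap_nonpos_iff.1 (gap_nonpos_of_mem_vertices hd.right_mem)
  have hdl := hd.left_lt_right
  have hel := he.left_lt_right
  have hlo := hnear _ (mem_endpoints_lo hpos hi)
  have hhi := hnear _ (mem_endpoints_hi hpos hi)
  -- The only endpoint between `t` and `t'` is `d.target`, so no other line changes side.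
  have hsame : ∀ k ∈ 𝓛, k ≠ d.line → 0 < k.gap t * k.gap t' := by
    intro k hk hkd
    have sk := hpos.isSecant hk
    have n : ∀ x, k.IsEndpoint x → x < t ∨ t' < x := by
      intro x hx
      rcases hnear x ⟨k, hk, hx⟩ with h1 | h1 | h1
      · exact Or.inl h1
      · exact absurd ⟨hx, h1 ▸ hend⟩ (hpos.endpoints_distinct k hk _ hi hkd x)
      · exact Or.inr h1
    have := sk.1
    rcases n _ (sk.isEndpoint_iff.2 (Or.inl rfl)) with h1 | h1 <;>
      rcases n _ (sk.isEndpoint_iff.2 (Or.inr rfl)) with h2 | h2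
    · exact mul_pos (sk.gap_pos_iff.2 (Or.inr h2)) (sk.gap_pos_iff.2 (Or.inr (by linarith)))
    · exact mul_pos_of_neg_of_neg (sk.gap_neg_iff.2 ⟨h1, by linarith⟩)
        (sk.gap_neg_iff.2 ⟨by linarith, h2⟩)
    · linarith
    · exact mul_pos (sk.gap_pos_iff.2 (Or.inl (by linarith))) (sk.gap_pos_iff.2 (Or.inl h1))
  have transfer : ∀ k ∈ 𝓛, k ≠ d.line → ∀ y, 0 ≤ y * k.gap t → 0 ≤ y * k.gap t' := by
    intro k hk hkd y hy
    have := nonneg_mul_of_pos_mul (a := k.gap t) (b := y) (g := k.gap t') (hsame k hk hkd)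
      (by rwa [mul_comm])
    exact this
  -- Both pieces of the line start at the same endpoint and have consecutive ends, so they coincide.
  have hpiece : e.left = d.left ∧ e.right = d.right ∧
      (e.side = Side.lower → d.line.gap t' < 0) ∧ (e.side = Side.upper → 0 < d.line.gap t') := by
    have c1 := hd.consecutive
    have c2 := he.consecutive
    have m1 := hd.left_mem
    have m2 := hd.right_mem
    have m3 := he.left_mem
    have m4 := he.right_mem
    rw [← hline] at c2 m3 m4
    cases hs : d.side <;> cases hs' : e.side <;> simp only [hs, hs', ne_eq, not_true] at hside
    · simp only [SubSegment.target, SubSegment.source, hs, hs'] at htgt hq ht' hhi hlo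
      have hr : d.right = d.line.hi := by
        rcases hq with hq | hq
        · linarith
        · exact hq
      refine ⟨?_, htgt.symm, by simp, fun _ => si.gap_pos_iff.2 (Or.inr (hr ▸ ht'))⟩
      by_contra hne
      rcases lt_or_gt_of_ne hne with h1 | h1
      · exact c2 _ m1 ⟨h1, htgt ▸ hdl⟩
      · exact c1 _ m3 ⟨h1, htgt ▸ hel⟩
    · simp only [SubSegment.target, SubSegment.source, hs, hs'] at htgt hq ht' hhi hlo htq
      have hr : d.left = d.line.lo := by
        rcases hq with hq | hq
        · exact hq
        · linarith
      refine ⟨htgt.symm, ?_, fun _ => si.gap_neg_iff.2 ⟨hr ▸ ht', ?_⟩, by simp⟩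
      · by_contra hne
        rcases lt_or_gt_of_ne hne with h1 | h1
        · exact c1 _ m4 ⟨htgt ▸ hel, h1⟩
        · exact c2 _ m2 ⟨htgt ▸ hdl, h1⟩
      · rcases hhi with h1 | h1 | h1 <;> linarith
  obtain ⟨e1, e2, e3, e4⟩ := hpiece
  refine ⟨t', ⟨he, hfree t' ht' le_rfl, hbefore, hline ▸ e3, hline ▸ e4, ?_, ?_⟩, htq, ht'⟩
  · intro k hk hke
    rw [← hline] at hke ⊢
    rw [e1]
    exact transfer k hk hke _ (h.left k hk hke)
  · intro k hk hke
    rw [← hline] at hke ⊢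
    rw [e2]
    exact transfer k hk hke _ (h.right k hk hke)

lemma InFace.exists_next (hpos : GeneralPosition 𝓛) (hconn : (intersectionGraph 𝓛).Connected)
    {t : ℝ} {d e : SubSegment} (h : InFace 𝓛 t d) (he : e.Valid 𝓛) (hde : d.Next e)
    (hlast : ¬ IsGreatest (endpoints 𝓛) d.target) :
    ∃ t', InFace 𝓛 t' e ∧ Precedes 𝓛 (d, t) (e, t') := by
  rcases hde with hde | hde
  · refine ⟨t, h.of_turnsInto hpos he hde, Or.inr ⟨rfl, ?_⟩⟩
    simp only [Line.direction]
    rw [hde.height_eq, hde.target_eq]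
  · obtain ⟨t', h1, h2, h3⟩ := h.of_goesAroundInto hpos hconn he hde hlast
    exact ⟨t', h1, Or.inl ⟨_, ⟨_, h.valid.line_mem, hde.endpoint⟩, h2, h3⟩⟩

/-- The tour starts in the face next to the leftmost endpoint. -/
lemma exists_inFace_of_isLeast (hpos : GeneralPosition 𝓛) {d : SubSegment} (hd : d.Valid 𝓛)
    (hmin : IsLeast (endpoints 𝓛) d.source) : ∃ t, InFace 𝓛 t d := by
  have hi := hd.line_mem
  have si := hpos.isSecant hi
  have g1 := si.gap_nonpos_iff.1 (gap_nonpos_of_mem_vertices hd.left_mem)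
  have g2 := si.gap_nonpos_iff.1 (gap_nonpos_of_mem_vertices hd.right_mem)
  have hlr := hd.left_lt_right
  have hlo := hmin.2 (mem_endpoints_lo hpos hi)
  have hside : d.side = Side.lower := by
    cases hs : d.side
    · rfl
    · simp only [SubSegment.source, hs] at hlo
      linarith
  simp only [SubSegment.source, hside] at hmin hlo
  have hleft : d.left = d.line.lo := le_antisymm hlo g1.1
  obtain ⟨t, ht, hfree⟩ := exists_gt_forall_notMem_endpoints hpos d.left
  have hafter : ∀ x ∈ endpoints 𝓛, d.left < x → t < x := fun x hx h1 => by
    by_contra! h2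
    exact hfree x h1 h2 hx
  have hhi := hafter _ (mem_endpoints_hi hpos hi) (hleft ▸ si.1)
  have hgt : ∀ k ∈ 𝓛, k ≠ d.line → 0 < k.gap t ∧ 0 < k.gap d.left := by
    intro k hk hkd
    have sk := hpos.isSecant hk
    have h1 : d.left < k.lo := by
      refine lt_of_le_of_ne (hmin.2 (mem_endpoints_lo hpos hk)) ?_
      rw [hleft]
      exact (ends_ne hpos hi hk hkd.symm).1
    exact ⟨sk.gap_pos_iff.2 (Or.inl (hafter _ (mem_endpoints_lo hpos hk) h1)),
      sk.gap_pos_iff.2 (Or.inl h1)⟩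
  have h0 : d.line.gap d.left = 0 :=
    Line.isEndpoint_iff_gap.1 (si.isEndpoint_iff.2 (Or.inl hleft))
  have hl : ∀ k ∈ 𝓛, k ≠ d.line → 0 < (d.line.height d.left - k.height d.left) * k.gap t := by
    intro k hk hkd
    obtain ⟨h1, h2⟩ := hgt k hk hkd
    refine mul_pos ?_ h1
    rw [Line.gap] at h0 h2
    linarith
  exact ⟨t, hd, hfree t ht le_rfl, ⟨_, mem_endpoints_hi hpos hi, hhi⟩,
    fun _ => si.gap_neg_iff.2 ⟨hleft ▸ ht, hhi⟩, by simp [hside], fun k hk hkd => (hl k hk hkd).le,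
    fun k hk hkd => nonneg_mul_of_pos_mul (hl k hk hkd) (hd.height_sub_mul_nonneg hpos hk hkd)⟩

lemma exists_faces_of_isChain (hpos : GeneralPosition 𝓛)
    (hconn : (intersectionGraph 𝓛).Connected) (T : List SubSegment) (d : SubSegment) (t : ℝ)
    (h : InFace 𝓛 t d) (hv : ∀ e ∈ T, e.Valid 𝓛) (hc : (d :: T).IsChain SubSegment.Next)
    (hlast : ∀ e ∈ (d :: T).dropLast, ¬ IsGreatest (endpoints 𝓛) e.target) :
    ∃ U : List (SubSegment × ℝ), U.map Prod.fst = T ∧ (∀ v ∈ U, InFace 𝓛 v.2 v.1) ∧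
      ((d, t) :: U).Pairwise (Precedes 𝓛) := by
  induction T generalizing d t with
  | nil => exact ⟨[], rfl, by simp, by simp⟩
  | cons e T ih =>
    rw [List.isChain_cons_cons] at hc
    rw [List.dropLast_cons_cons] at hlast
    obtain ⟨t', h1, h2⟩ := h.exists_next hpos hconn (hv e (by simp)) hc.1 (hlast d (by simp))
    obtain ⟨U, hU, hface, hpair⟩ := ih e t' h1 (fun x hx => hv x (by simp [hx])) hc.2
      (fun x hx => hlast x (by simp [hx]))
    refine ⟨(e, t') :: U, by simp [hU], ?_, ?_⟩
    · simpa using ⟨h1, fun a b => hface (a, b)⟩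
    · rw [List.pairwise_cons]
      refine ⟨fun v hv => ?_, hpair⟩
      rcases List.mem_cons.1 hv with rfl | hv
      · exact h2
      · exact h2.trans h1 ((List.pairwise_cons.1 hpair).1 v hv)

lemma IsTour.exists_faces (hpos : GeneralPosition 𝓛) (hconn : (intersectionGraph 𝓛).Connected)
    {T : List SubSegment} (hT : IsTour 𝓛 T) :
    ∃ U : List (SubSegment × ℝ), U.map Prod.fst = T ∧ (∀ v ∈ U, InFace 𝓛 v.2 v.1) ∧
      U.Pairwise (Precedes 𝓛) := by
  obtain ⟨d, hd, hmin⟩ := hT.starts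
  cases T with
  | nil => simp at hd
  | cons d' T =>
    obtain rfl : d' = d := by simpa using hd
    obtain ⟨t, ht⟩ := exists_inFace_of_isLeast hpos (hT.valid d' (by simp)) hmin
    obtain ⟨U, h1, h2, h3⟩ := exists_faces_of_isChain hpos hconn T d' t ht
      (fun x hx => hT.valid x (by simp [hx])) hT.walks hT.not_before
    exact ⟨(d', t) :: U, by simp [h1], by simpa using ⟨ht, fun a b => h2 (a, b)⟩, h3⟩

end Face

/-! ### Alternations in the lower sequence -/

section Alternation

variable {𝓛 : Finset Line}

/-- The visit `v` to a lower-side sub-segment of the line `a` in the face of `v.2`. -/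
structure LowerVisit (𝓛 : Finset Line) (a : Line) (v : SubSegment × ℝ) : Prop where
  inFace : InFace 𝓛 v.2 v.1
  side : v.1.side = Side.lower
  line : v.1.line = a

namespace LowerVisit

variable {a k : Line} {v : SubSegment × ℝ}

lemma mem (h : LowerVisit 𝓛 a v) : a ∈ 𝓛 := h.line ▸ h.inFace.valid.line_mem

lemma gap_neg (h : LowerVisit 𝓛 a v) : a.gap v.2 < 0 := h.line ▸ h.inFace.lower h.side

lemma lo_lt (hpos : GeneralPosition 𝓛) (h : LowerVisit 𝓛 a v) : a.lo < v.2 :=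
  ((hpos.isSecant h.mem).gap_neg_iff.1 h.gap_neg).1

lemma lt_hi (hpos : GeneralPosition 𝓛) (h : LowerVisit 𝓛 a v) : v.2 < a.hi :=
  ((hpos.isSecant h.mem).gap_neg_iff.1 h.gap_neg).2

lemma left_lt_right (h : LowerVisit 𝓛 a v) : v.1.left < v.1.right := h.inFace.valid.left_lt_right

lemma gap_left (h : LowerVisit 𝓛 a v) : a.gap v.1.left ≤ 0 :=
  h.line ▸ gap_nonpos_of_mem_vertices h.inFace.valid.left_mem

lemma gap_right (h : LowerVisit 𝓛 a v) : a.gap v.1.right ≤ 0 :=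
  h.line ▸ gap_nonpos_of_mem_vertices h.inFace.valid.right_mem

lemma lo_le_left (hpos : GeneralPosition 𝓛) (h : LowerVisit 𝓛 a v) : a.lo ≤ v.1.left :=
  ((hpos.isSecant h.mem).gap_nonpos_iff.1 h.gap_left).1

lemma right_le_hi (hpos : GeneralPosition 𝓛) (h : LowerVisit 𝓛 a v) : v.1.right ≤ a.hi :=
  ((hpos.isSecant h.mem).gap_nonpos_iff.1 h.gap_right).2

lemma height_le (h : LowerVisit 𝓛 a v) (hk : k ∈ 𝓛) (hka : k ≠ a) (hg : k.gap v.2 < 0) :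
    a.height v.1.left ≤ k.height v.1.left ∧ a.height v.1.right ≤ k.height v.1.right := by
  have h1 := h.inFace.left k hk (h.line ▸ hka)
  have h2 := h.inFace.right k hk (h.line ▸ hka)
  rw [h.line] at h1 h2
  exact ⟨by by_contra! hc; nlinarith, by by_contra! hc; nlinarith⟩

lemma le_height (h : LowerVisit 𝓛 a v) (hk : k ∈ 𝓛) (hka : k ≠ a) (hg : 0 < k.gap v.2) :
    k.height v.1.left ≤ a.height v.1.left ∧ k.height v.1.right ≤ a.height v.1.right := by
  have h1 := h.inFace.left k hk (h.line ▸ hka)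
  have h2 := h.inFace.right k hk (h.line ▸ hka)
  rw [h.line] at h1 h2
  exact ⟨by by_contra! hc; nlinarith, by by_contra! hc; nlinarith⟩

/-- A chord is not visited from below in a face that lies under a chord nested inside it. -/
lemma gap_pos_of_nested (hpos : GeneralPosition 𝓛) (h : LowerVisit 𝓛 a v) (hk : k ∈ 𝓛)
    (hlo : a.lo < k.lo) (hhi : k.hi < a.hi) : v.2 < k.lo ∨ k.hi < v.2 := by
  have sa := hpos.isSecant h.mem
  have sk := hpos.isSecant hk
  have hka : k ≠ a := by rintro rfl; exact hlo.false
  rw [← sk.gap_pos_iff]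
  by_contra! hg
  have hg := lt_of_le_of_ne hg (gap_ne_zero_of_notMem_endpoints hk h.inFace.notMem)
  have h1 := (h.height_le hk hka hg).1
  have h2 := sa.gap_nonpos_iff.1 h.gap_left
  have h3 : v.1.left < a.hi := h.left_lt_right.trans_le (h.right_le_hi hpos)
  rw [sa.height_eq, sk.height_eq] at h1
  nlinarith [mul_nonneg (sub_nonneg.2 h2.1) (sub_pos.2 hhi).le, mul_pos (sub_pos.2 hlo)
    (sub_pos.2 h3), mul_pos (sub_pos.2 hlo) (sub_pos.2 hhi), sk.1]

end LowerVisit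

lemma height_sub_interpolation (a b : Line) (x y z : ℝ) :
    (z - x) * (a.height y - b.height y) =
      (z - y) * (a.height x - b.height x) + (y - x) * (a.height z - b.height z) := by
  simp only [Line.height]; ring

lemma height_sub_height_lo {a : Line} (ha : a.IsSecant) (k : Line) :
    a.height a.lo - k.height a.lo = k.gap a.lo := by
  rw [ha.height_eq, Line.gap]; ring

lemma height_sub_height_hi {a : Line} (ha : a.IsSecant) (k : Line) :
    a.height a.hi - k.height a.hi = k.gap a.hi := by
  rw [ha.height_eq, Line.gap]; ring

/-- Under two crossing chords, the one that ends first is visited only after the other. -/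
lemma not_precedes_of_crossing (hpos : GeneralPosition 𝓛)
    (hconn : (intersectionGraph 𝓛).Connected) {a b : Line} {v w : SubSegment × ℝ}
    (hv : LowerVisit 𝓛 a v) (hw : LowerVisit 𝓛 b w) (h1 : a.lo < b.lo) (h3 : a.hi < b.hi)
    (hbv : b.lo < v.2) (haw : w.2 < a.hi) : ¬ Precedes 𝓛 v w := by
  intro hvw
  have sa := hpos.isSecant hv.mem
  have sb := hpos.isSecant hw.mem
  have hab : b ≠ a := by rintro rfl; exact h1.false
  have hle := hvw.le
  have gbv : b.gap v.2 < 0 := sb.gap_neg_iff.2 ⟨hbv, by linarith⟩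
  have gaw : a.gap w.2 < 0 := sa.gap_neg_iff.2 ⟨by linarith, haw⟩
  have hA := (hv.height_le hw.mem hab gbv).1
  have hB := (hw.height_le hv.mem hab.symm gaw).2
  have hvl := hv.left_lt_right
  have hwl := hw.left_lt_right
  have hm : a.slope - b.slope < 0 := by rw [sa.2.1, sb.2.1]; linarith
  -- `X` is the crossing. Below both chords only `a` right of `X` and `b` left of `X` can be
  -- visited.
  obtain ⟨X, hX⟩ : ∃ X, a.height X = b.height X := by
    refine ⟨(b.intercept - a.intercept) / (a.slope - b.slope), ?_⟩
    have h4 : (a.slope - b.slope) * ((b.intercept - a.intercept) / (a.slope - b.slope)) =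
      b.intercept - a.intercept := mul_div_cancel₀ _ hm.ne
    simp only [Line.height]
    linarith
  have hdiff : ∀ x, a.height x - b.height x = (a.slope - b.slope) * (x - X) := by
    intro x; simp only [Line.height] at hX ⊢; linear_combination hX
  have hXA : X < v.1.right := by
    refine lt_of_le_of_lt ?_ hvl
    by_contra! hc
    have := hdiff v.1.left
    nlinarith [mul_pos_of_neg_of_neg hm (sub_neg.2 hc)]
  have hBX : w.1.left < X := by
    refine lt_of_lt_of_le hwl ?_
    by_contra! hc
    have := hdiff w.1.right
    nlinarith [mul_pos (neg_pos.2 hm) (sub_pos.2 hc)]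
  have hAhi := hv.right_le_hi hpos
  have hBlo := hw.lo_le_left hpos
  rcases hvw with ⟨q, ⟨c, hc, hcq⟩, hvq, hqw⟩ | ⟨heq, hdir⟩
  -- Different faces: by connectedness some chord has exactly one end between the two abscissas.
  · obtain ⟨k, hk, hkg⟩ : ∃ k ∈ 𝓛, k.gap v.2 * k.gap w.2 < 0 := by
      by_contra! hall
      have hall' : ∀ k ∈ 𝓛, (v.2 ≤ k.lo ∧ k.hi ≤ w.2) ∨ k.hi ≤ v.2 ∨ w.2 ≤ k.lo ∨
          (k.lo ≤ v.2 ∧ w.2 ≤ k.hi) := fun k hk =>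
        in_or_out_of_gap_mul_pos (hpos.isSecant hk) (lt_of_le_of_ne (hall k hk)
          (mul_ne_zero (gap_ne_zero_of_notMem_endpoints hk hv.inFace.notMem)
            (gap_ne_zero_of_notMem_endpoints hk hw.inFace.notMem)).symm)
      have hPc : v.2 ≤ c.lo ∧ c.hi ≤ w.2 := by
        have hlt := (hpos.isSecant hc).1
        have hx := (hpos.isSecant hc).isEndpoint_iff.1 hcq
        rcases hall' c hc with hP | h1 | h1 | ⟨h1, h2⟩
        · exact hP
        all_goals rcases hx with rfl | rfl <;> exfalso <;> linarith
      have := inside_of_connected hpos hconn hall' hc hPc.1 hPc.2 a hv.mem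
      linarith [this.1]
    have sk := hpos.isSecant hk
    have hka : k ≠ a := by
      rintro rfl; exact absurd hkg (mul_pos_of_neg_of_neg hv.gap_neg gaw).le.not_gt
    have hkb : k ≠ b := by
      rintro rfl; exact absurd hkg (mul_pos_of_neg_of_neg gbv hw.gap_neg).le.not_gt
    rcases mul_neg_iff.1 hkg with ⟨g1, g2⟩ | ⟨g1, g2⟩
    -- Here `k` starts in between. `a` is above `k` at `a.lo` and not below it at `v.1.right`, hence
    -- above it at `X`; so `b` is above `k` from `b.lo` to `X`, and `w` cannot see it under `k`.
    · have hlo : v.2 < k.lo := by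
        rcases sk.gap_pos_iff.1 g1 with h | h
        · exact h
        · linarith [(sk.gap_neg_iff.1 g2).2]
      have f1 := (hv.le_height hk hka g1).2
      have f2 := (hw.height_le hk hkb g2).1
      have f3 : 0 < k.gap a.lo := sk.gap_pos_iff.2 (Or.inl (by linarith))
      have f4 : 0 < k.gap b.lo := sk.gap_pos_iff.2 (Or.inl (by linarith))
      rw [← height_sub_height_lo sa] at f3
      rw [← height_sub_height_lo sb] at f4
      have i1 := height_sub_interpolation a k a.lo X v.1.right
      have i2 := height_sub_interpolation b k b.lo w.1.left X
      have f5 : 0 < a.height X - k.height X := by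
        refine (mul_pos_iff_of_pos_left (by linarith : 0 < v.1.right - a.lo)).1 ?_
        rw [i1]
        exact add_pos_of_pos_of_nonneg (mul_pos (by linarith) f3)
          (mul_nonneg (by linarith) (by linarith))
      nlinarith [mul_pos (sub_pos.2 hBX) f4, mul_nonneg (sub_nonneg.2 hBlo) f5.le,
        mul_nonneg (sub_nonneg.2 (hBlo.trans hBX.le)) (sub_nonneg.2 f2)]
    -- Here `k` ends in between, and the same argument runs from right to left.
    · have hhi : k.hi < w.2 := by
        rcases sk.gap_pos_iff.1 g2 with h | h
        · linarith [(sk.gap_neg_iff.1 g1).1]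
        · exact h
      have f1 := (hv.height_le hk hka g1).2
      have f2 := (hw.le_height hk hkb g2).1
      have f3 : 0 < k.gap a.hi := sk.gap_pos_iff.2 (Or.inr (by linarith))
      have f4 : 0 < k.gap b.hi := sk.gap_pos_iff.2 (Or.inr (by linarith))
      rw [← height_sub_height_hi sa] at f3
      rw [← height_sub_height_hi sb] at f4
      have i1 := height_sub_interpolation a k X v.1.right a.hi
      have i2 := height_sub_interpolation b k w.1.left X b.hi
      have f5 : 0 < b.height X - k.height X := by
        refine (mul_pos_iff_of_pos_left (by linarith : 0 < b.hi - w.1.left)).1 ?_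
        rw [i2]
        exact add_pos_of_nonneg_of_pos (mul_nonneg (by linarith) (by linarith))
          (mul_pos (by linarith) f4)
      rw [← hX] at f5
      nlinarith [mul_pos (sub_pos.2 hXA) f3, mul_nonneg (sub_nonneg.2 hAhi) f5.le,
        mul_nonneg (sub_nonneg.2 (hXA.le.trans hAhi)) (sub_nonneg.2 f1)]
  -- Same face: clockwise, the piece of `a` ends after `X` while that of `b` starts before it.
  · simp only [SubSegment.target, SubSegment.source, hv.side, hw.side, hv.line, hw.line] at hdir
    rw [heq] at hdir
    have gaX : a.gap X ≤ 0 := sa.gap_nonpos_iff.2 ⟨by linarith, by linarith⟩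
    have gbX : b.gap X ≤ 0 := sb.gap_nonpos_iff.2 ⟨by linarith, by linarith⟩
    have d1 := direction_lt_of_gap_neg gaw gaX hv.gap_right hXA
    have d2 := direction_lt_of_gap_neg hw.gap_neg hw.gap_left gbX hBX
    have d3 : a.direction w.2 X = b.direction w.2 X := by simp only [Line.direction, hX]
    linarith

/-- What an alternation `a b a b` in the lower sequence says about the chords `a` and `b` and
about the four visits. -/
structure Alternates (a b : Line) (v₁ v₂ v₃ v₄ : SubSegment × ℝ) : Prop where
  lo_lt_lo : a.lo < b.lo
  hi_lt_hi : a.hi < b.hi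
  fst_lt_lo : v₁.2 < b.lo
  lo_lt_hi : b.lo < a.hi
  hi_lt_fourth : a.hi < v₄.2
  snd_below : b.height v₂.1.left ≤ a.height v₂.1.left
  third_below : a.height v₃.1.left ≤ b.height v₃.1.left

/-- The middle visits exclude nesting by `gap_pos_of_nested`. Applying `not_precedes_of_crossing` to
the subword b a excludes the opposite crossing order, and applying it to the first and the last a b
places the outer visits. -/
lemma alternates (hpos : GeneralPosition 𝓛) (hconn : (intersectionGraph 𝓛).Connected)
    {a b : Line} (hab : a ≠ b) {v₁ v₂ v₃ v₄ : SubSegment × ℝ}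
    (h₁ : LowerVisit 𝓛 a v₁) (h₂ : LowerVisit 𝓛 b v₂) (h₃ : LowerVisit 𝓛 a v₃)
    (h₄ : LowerVisit 𝓛 b v₄) (h₁₂ : Precedes 𝓛 v₁ v₂) (h₂₃ : Precedes 𝓛 v₂ v₃)
    (h₃₄ : Precedes 𝓛 v₃ v₄) : Alternates a b v₁ v₂ v₃ v₄ := by
  have sa := hpos.isSecant h₁.mem
  have sb := hpos.isSecant h₂.mem
  obtain ⟨n1, n2, n3, n4⟩ := ends_ne hpos h₁.mem h₂.mem hab
  have l₁ := h₁.lo_lt hpos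
  have l₂ := h₂.lo_lt hpos
  have r₃ := h₃.lt_hi hpos
  have r₄ := h₄.lt_hi hpos
  have t₁ := h₁₂.le
  have t₂ := h₂₃.le
  have t₃ := h₃₄.le
  have hb_hi : a.hi < b.hi := by
    by_contra! hc
    have hc := lt_of_le_of_ne hc n4.symm
    rcases lt_or_gt_of_ne n1 with h | h
    · rcases h₃.gap_pos_of_nested hpos h₂.mem h hc with h' | h' <;> linarith
    · exact not_precedes_of_crossing hpos hconn h₂ h₃ h hc (by linarith) (by linarith) h₂₃
  have hb_lo : a.lo < b.lo := by
    by_contra! hc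
    have hc := lt_of_le_of_ne hc n1.symm
    rcases h₂.gap_pos_of_nested hpos h₁.mem hc hb_hi with h' | h' <;> linarith
  have hne : ∀ v, LowerVisit 𝓛 a v → v.2 ≠ b.lo := fun v hv h =>
    hv.inFace.notMem (h ▸ mem_endpoints_lo hpos h₂.mem)
  have hne' : v₄.2 ≠ a.hi := fun h => h₄.inFace.notMem (h ▸ mem_endpoints_hi hpos h₁.mem)
  refine ⟨hb_lo, hb_hi, ?_, by linarith, ?_, ?_, ?_⟩
  · by_contra! hc
    exact not_precedes_of_crossing hpos hconn h₁ h₂ hb_lo hb_hi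
      (lt_of_le_of_ne hc (hne _ h₁).symm) (by linarith) h₁₂
  · by_contra! hc
    exact not_precedes_of_crossing hpos hconn h₃ h₄ hb_lo hb_hi (by linarith)
      (lt_of_le_of_ne hc hne') h₃₄
  · exact (h₂.height_le h₁.mem hab (sa.gap_neg_iff.2 ⟨by linarith, by linarith⟩)).1
  · exact (h₃.height_le h₂.mem hab.symm (sb.gap_neg_iff.2 ⟨by linarith, by linarith⟩)).1

end Alternation

/-! ### The forbidden configuration of chords -/

/-- If the chord `b` passes below the crossing of `a` and `c`, then its distances to `c` compare
with those of `a`. -/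
lemma mul_lt_mul_of_below {a b c : Line} (ha : a.IsSecant) (hb : b.IsSecant) (hc : c.IsSecant)
    (h1 : a.lo < b.lo) (h2 : b.lo < c.lo) (h3 : a.hi < b.hi) (h4 : b.hi < c.hi)
    {x : ℝ} (hxa : b.height x ≤ a.height x) (hxc : b.height x ≤ c.height x) :
    (c.hi - a.hi) * (c.lo - b.lo) * (b.hi - c.lo) <
      (c.hi - b.hi) * (c.lo - a.lo) * (a.hi - c.lo) := by
  rw [ha.height_eq, hb.height_eq] at hxa
  rw [hc.height_eq, hb.height_eq] at hxc
  -- In `k1 + k2` the abscissa `x` cancels, leaving the concurrency determinant of the three lines;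
  -- `k3` is exactly its difference from the claim.
  have k1 := mul_nonneg (by linarith : 0 ≤ c.lo + c.hi - (b.lo + b.hi)) (sub_nonneg.2 hxa)
  have k2 := mul_nonneg (by linarith : 0 ≤ b.lo + b.hi - (a.lo + a.hi)) (sub_nonneg.2 hxc)
  have k3 := mul_pos (mul_pos (by linarith : 0 < c.lo - a.lo) (by linarith : 0 < c.lo - b.lo))
    (by linarith : 0 < b.hi - a.hi)
  nlinarith

/-- The mirror image of `mul_lt_mul_of_below`. -/
lemma mul_lt_mul_of_below' {c d e : Line} (hc : c.IsSecant) (hd : d.IsSecant) (he : e.IsSecant)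
    (h1 : c.lo < d.lo) (h2 : d.lo < e.lo) (h3 : c.hi < d.hi) (h4 : d.hi < e.hi)
    {x : ℝ} (hxc : d.height x ≤ c.height x) (hxe : d.height x ≤ e.height x) :
    (e.lo - c.lo) * (d.hi - c.hi) * (c.hi - d.lo) <
      (d.lo - c.lo) * (e.hi - c.hi) * (c.hi - e.lo) := by
  rw [hc.height_eq, hd.height_eq] at hxc
  rw [he.height_eq, hd.height_eq] at hxe
  have k1 := mul_nonneg (by linarith : 0 ≤ e.lo + e.hi - (d.lo + d.hi)) (sub_nonneg.2 hxc)
  have k2 := mul_nonneg (by linarith : 0 ≤ d.lo + d.hi - (c.lo + c.hi)) (sub_nonneg.2 hxe)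
  have k3 := mul_pos (mul_pos (by linarith : 0 < e.hi - c.hi) (by linarith : 0 < d.hi - c.hi))
    (by linarith : 0 < e.lo - d.lo)
  nlinarith

/-- The numerical contradiction: `α, β` are the distances of the left ends of `a, b` from that of
`c`, `δ, ε` those of `d, e`, `α', β', δ', ε'` those of the right ends, and `w` is the width of
`c`. -/
lemma false_of_distances {α β δ ε α' β' δ' ε' w : ℝ} (hβ : 0 < β) (hδ : 0 < δ)
    (hδε : δ < ε) (hε : ε < w) (hβ' : 0 < β') (hαβ' : β' < α') (hα' : α' < w) (hδ' : 0 < δ')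
    (h1 : α' * β * (w - β') < β' * α * (w - α')) (h2 : ε * δ' * (w - δ) < δ * ε' * (w - ε))
    (h3 : α * δ < β * ε) (h4 : ε' * β' < δ' * α') : False := by
  have k1 : α' * δ * (w - β') < β' * ε * (w - α') := by
    have : β * (α' * δ * (w - β')) < β * (β' * ε * (w - α')) := by
      have e1 := mul_lt_mul_of_pos_right h1 hδ
      have e2 := mul_lt_mul_of_pos_left h3 (mul_pos hβ' (sub_pos.2 hα'))
      linarith
    exact lt_of_mul_lt_mul_left this hβ.le
  have k2 : ε * β' * (w - δ) < δ * α' * (w - ε) := by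
    have : δ' * (ε * β' * (w - δ)) < δ' * (δ * α' * (w - ε)) := by
      have e1 := mul_lt_mul_of_pos_right h2 hβ'
      have e2 := mul_lt_mul_of_pos_left h4 (mul_pos hδ (sub_pos.2 hε))
      linarith
    exact lt_of_mul_lt_mul_left this hδ'.le
  have e1 : α' * δ * (w - α') < α' * δ * (w - β') :=
    mul_lt_mul_of_pos_left (by linarith) (mul_pos (hβ'.trans hαβ') hδ)
  have e2 : ε * β' * (w - ε) < ε * β' * (w - δ) :=
    mul_lt_mul_of_pos_left (by linarith) (mul_pos (hδ.trans hδε) hβ')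
  have e3 : α' * δ < β' * ε := lt_of_mul_lt_mul_right (e1.trans k1) (sub_pos.2 hα').le
  have e4 : ε * β' < δ * α' := lt_of_mul_lt_mul_right (e2.trans k2) (sub_pos.2 hε).le
  linarith

/-! ### The pattern in the lower sequence -/

section Pattern

variable {𝓛 : Finset Line}

/-- Lets a subsequence of symbols be lifted to visits that still carry their faces. -/
lemma filterMap_lowerSymbol (U : List (SubSegment × ℝ)) :
    (U.map Prod.fst).filterMap SubSegment.lowerSymbol =
      (U.filter fun v => v.1.lowerSymbol.isSome).map fun v => v.1.line := by
  induction U with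
  | nil => rfl
  | cons v U ih => cases hs : v.1.side <;> 
    simp only [List.map_cons, List.filterMap_cons, List.filter_cons, ih, SubSegment.lowerSymbol, hs,
      Option.isSome_some, Option.isSome_none, if_true, Bool.false_eq_true, if_false]

/-- An occurrence of the word `p`, renamed by `f`, in the lower sequence yields a visit for each
of its letters. -/
lemma exists_visits (hpos : GeneralPosition 𝓛) (hconn : (intersectionGraph 𝓛).Connected)
    {S : List Line} (hS : IsLowerInnerZoneSequence 𝓛 S) {α : Type*} (p : List α) (f : α → Line)
    (hp : (p.map f).Sublist S) :
    ∃ V : Fin p.length → SubSegment × ℝ, (∀ i, LowerVisit 𝓛 (f (p.get i)) (V i)) ∧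
      ∀ i j, i < j → Precedes 𝓛 (V i) (V j) := by
  obtain ⟨T, hT, rfl⟩ := hS
  obtain ⟨U, rfl, hface, hpair⟩ := hT.exists_faces hpos hconn
  rw [filterMap_lowerSymbol, List.sublist_map_iff] at hp
  obtain ⟨W, hW, hmap⟩ := hp
  have hlen : p.length = W.length := by simpa using congrArg List.length hmap
  refine ⟨fun i => W.get (i.cast hlen), fun i => ?_, fun i j hij => ?_⟩
  · have hmem := List.mem_filter.1 (hW.subset (List.get_mem W (i.cast hlen)))
    refine ⟨hface _ hmem.1, ?_, ?_⟩
    · have := hmem.2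
      cases hs : (W.get (i.cast hlen)).1.side
      · rfl
      · simp only [SubSegment.lowerSymbol, hs] at this
        exact absurd this (by simp)
    · have := List.getElem_of_eq hmap (i := i) (by simp)
      simpa using this.symm
  · exact List.pairwise_iff_get.1 (hpair.sublist (hW.trans List.filter_sublist)) _ _ hij

lemma height_lt_height_of_le {a b : Line} (hab : a.slope < b.slope) {x y : ℝ} (hxy : x < y)
    (hx : a.height x ≤ b.height x) : a.height y < b.height y := by
  simp only [Line.height] at hx ⊢
  nlinarith [mul_pos (sub_pos.2 hab) (sub_pos.2 hxy)]

lemma mem_pattern (x : Letter) : x ∈ pattern := by cases x <;> decide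

open Letter in
/-- The pattern does not occur in the lower sequence. -/
lemma not_sublist_pattern (hpos : GeneralPosition 𝓛) (hconn : (intersectionGraph 𝓛).Connected)
    {S : List Line} (hS : IsLowerInnerZoneSequence 𝓛 S) {f : Letter → Line}
    (hf : f.Injective) : ¬ (pattern.map f).Sublist S := by
  intro hw
  obtain ⟨V, hV, hprec⟩ : ∃ V : Fin 33 → SubSegment × ℝ,
      (∀ i : Fin 33, LowerVisit 𝓛 (f (pattern.get i)) (V i)) ∧
        ∀ i j : Fin 33, i < j → Precedes 𝓛 (V i) (V j) :=
    exists_visits hpos hconn hS pattern f hw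
  -- `i j k l` are positions in the pattern, counted from 0, of an alternation x y x y.
  have alt : ∀ (x y : Letter) (i j k l : Fin 33), (x ≠ y ∧ i < j ∧ j < k ∧ k < l ∧
      pattern.get i = x ∧ pattern.get j = y ∧ pattern.get k = x ∧ pattern.get l = y) →
      Alternates (f x) (f y) (V i) (V j) (V k) (V l) := by
    rintro x y i j k l ⟨hxy, hij, hjk, hkl, hi, hj, hk, hl⟩
    exact alternates hpos hconn (hf.ne hxy) (hi ▸ hV i) (hj ▸ hV j) (hk ▸ hV k) (hl ▸ hV l)
      (hprec i j hij) (hprec j k hjk) (hprec k l hkl)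
  have sec : ∀ x, (f x).IsSecant := fun x => by
    obtain ⟨i, rfl⟩ := List.get_of_mem (mem_pattern x)
    exact hpos.isSecant (hV i).mem
  have A12 := alt n1 n2 4 5 6 12 (by decide)
  have A81 := alt n8 n1 0 6 7 8 (by decide)
  have A1c := alt n1 c 8 9 11 16 (by decide)
  have A1a := alt n1 a 1 2 4 18 (by decide)
  have A1d := alt n1 d 8 10 11 13 (by decide)
  have A2d := alt n2 d 5 10 12 13 (by decide)
  have Ade := alt d e 13 14 15 30 (by decide)
  have Acd := alt c d 9 15 16 29 (by decide)
  have Aab := alt a b 2 17 18 19 (by decide)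
  have Abc := alt b c 3 9 17 23 (by decide)
  have Ab3 := alt b n3 19 20 22 27 (by decide)
  have Aae := alt a e 2 14 18 30 (by decide)
  have Ae4 := alt e n4 14 21 30 31 (by decide)
  have Ab4 := alt b n4 19 21 22 24 (by decide)
  have A34 := alt n3 n4 20 26 27 28 (by decide)
  have A49 := alt n4 n9 24 25 26 32 (by decide)
  have Ac4 := alt c n4 16 21 23 24 (by decide)
  have b_lt_2 : (f b).lo < (f n2).lo :=
    ((hV 3).lo_lt hpos).trans_le ((hprec 3 4 (by decide)).le.trans A12.fst_lt_lo.le)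
  have h3_lt_d : (f n3).hi < (f d).hi :=
    A34.hi_lt_fourth.trans ((hprec 28 29 (by decide)).le.trans_lt ((hV 29).lt_hi hpos))
  have h2_lt_e : (f n2).hi < (f e).lo := A2d.hi_lt_fourth.trans Ade.fst_lt_lo
  have ha_lt_3 : (f a).hi < (f n3).lo := Aab.hi_lt_fourth.trans Ab3.fst_lt_lo
  have h8_lt_c : (f n8).hi < (f c).lo := A81.hi_lt_fourth.trans A1c.fst_lt_lo
  have hc_lt_9 : (f c).hi < (f n9).lo := Ac4.hi_lt_fourth.trans A49.fst_lt_lo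
  -- The products are the heights of 1 and 2 above the parabola at `c.lo`. Visit 6 to chord 1 starts
  -- below 2 and below 8, and 8 ends before c begins, so the steeper 2 is above 1 at `c.lo`.
  have left : ((f c).lo - (f n1).lo) * ((f n1).hi - (f c).lo) <
      ((f c).lo - (f n2).lo) * ((f n2).hi - (f c).lo) := by
    have h1 := A12.third_below
    have h2 := A81.snd_below
    have h3 : (f n1).gap (V 6).1.left ≤ 0 := (hV 6).gap_left
    have h4 : (f n8).gap (V 6).1.left ≤ 0 := by rw [Line.gap] at h3 ⊢; linarith
    have h5 := height_lt_height_of_le (by rw [(sec n1).2.1, (sec n2).2.1]; linarith [A12.lo_lt_lo,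
      A12.hi_lt_hi]) (((sec n8).gap_nonpos_iff.1 h4).2.trans_lt h8_lt_c) h1
    rw [(sec n1).height_eq, (sec n2).height_eq] at h5
    linarith
  -- Mirror image at `c.hi`: visit 26 to chord 4 starts below 3 and below 9, and 9 begins after c
  -- ends.
  have right : ((f n4).hi - (f c).hi) * ((f c).hi - (f n4).lo) <
      ((f n3).hi - (f c).hi) * ((f c).hi - (f n3).lo) := by
    have h1 := A34.snd_below
    have h2 := A49.third_below
    have h3 : (f n4).gap (V 26).1.left ≤ 0 := (hV 26).gap_left
    have h4 : (f n9).gap (V 26).1.left ≤ 0 := by rw [Line.gap] at h3 ⊢; linarith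
    have h5 : (f n4).height (f c).hi < (f n3).height (f c).hi := by
      by_contra! h6
      refine (height_lt_height_of_le (by rw [(sec n3).2.1, (sec n4).2.1]; linarith [A34.lo_lt_lo,
        A34.hi_lt_hi]) (hc_lt_9.trans_le ((sec n9).gap_nonpos_iff.1 h4).1) h6).not_ge h1
    rw [(sec n3).height_eq, (sec n4).height_eq] at h5
    linarith
  obtain ⟨b1, b2, -, b4, -, b6, -⟩ := Aab
  obtain ⟨c1, c2, -, c4, -, -, c7⟩ := Abc
  obtain ⟨d1, d2, -, d4, -, d6, -⟩ := Acd
  obtain ⟨e1, e2, -, e4, -, -, e7⟩ := Ade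
  have ae := Aae.lo_lt_hi
  have p1 := A1a.lo_lt_lo
  have p2 := A1d.lo_lt_hi
  have p3 := A12.hi_lt_hi
  have p4 := Ae4.hi_lt_hi
  have p5 := Ab4.lo_lt_hi
  have p6 := A34.lo_lt_lo
  -- `hl` and `hr` supply the signs needed to compare the products factor by factor.
  have hl : (f n2).lo < (f c).lo := by
    by_contra! h
    nlinarith [mul_pos (by linarith : 0 < (f c).lo - (f n1).lo)
      (by linarith : 0 < (f n1).hi - (f c).lo), mul_nonneg (sub_nonneg.2 h)
      (by linarith : 0 ≤ (f n2).hi - (f c).lo)]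
  have hr : (f c).hi < (f n3).hi := by
    by_contra! h
    nlinarith [mul_pos (by linarith : 0 < (f n4).hi - (f c).hi)
      (by linarith : 0 < (f c).hi - (f n4).lo), mul_nonneg (sub_nonneg.2 h)
      (by linarith : 0 ≤ (f c).hi - (f n3).lo)]
  -- The witnesses are the left ends of visit 17 to b, below a and c, and of visit 15 to d, below c
  -- and e.
  have k1 := mul_lt_mul_of_below (sec a) (sec b) (sec c) b1 c1 b2 c2 b6 c7
  have k2 := mul_lt_mul_of_below' (sec c) (sec d) (sec e) d1 e1 d2 e2 d6 e7
  refine false_of_distances (α := (f c).lo - (f a).lo) (β := (f c).lo - (f b).lo)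
    (δ := (f d).lo - (f c).lo) (ε := (f e).lo - (f c).lo) (α' := (f c).hi - (f a).hi)
    (β' := (f c).hi - (f b).hi) (δ' := (f d).hi - (f c).hi) (ε' := (f e).hi - (f c).hi)
    (w := (f c).hi - (f c).lo) (by linarith) (by linarith) (by linarith) (by linarith)
    (by linarith) (by linarith) (by linarith) (by linarith) (by linarith) (by linarith) ?_ ?_
  · calc _ ≤ ((f c).lo - (f n1).lo) * ((f n1).hi - (f c).lo) := by
          apply mul_le_mul <;> linarith
      _ < _ := left
      _ ≤ _ := by apply mul_le_mul <;> linarith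
  · calc _ ≤ ((f n4).hi - (f c).hi) * ((f c).hi - (f n4).lo) := by
          apply mul_le_mul <;> linarith
      _ < _ := right
      _ ≤ _ := by apply mul_le_mul <;> linarith

end Pattern

end ParabolaZone

theorem mainTheorem2 (𝓛 : Finset ParabolaZone.Line)
    (hpos : ParabolaZone.GeneralPosition 𝓛)
    (hconn : (ParabolaZone.intersectionGraph 𝓛).Connected)
    (S : List ParabolaZone.Line) (hS : ParabolaZone.IsLowerInnerZoneSequence 𝓛 S) :
    ¬ ∃ w : List ParabolaZone.Line,
      w.Sublist S ∧ ParabolaZone.Isomorphic ParabolaZone.pattern w := by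
  rintro ⟨_, hw, f, hf, rfl⟩
  exact ParabolaZone.not_sublist_pattern hpos hconn hS
    (fun x y h => hf (ParabolaZone.mem_pattern x) (ParabolaZone.mem_pattern y) h) hw
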